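/- Let \(q\in\mathbb N\) and let \(\mathbb T\) be the homogeneous tree of degree \(q+1\) with graph distance \(d\), let \(\partial\mathbb T\) be its boundary (geodesic rays modulo coincidence up to finitely many vertices), and give \(\mathbb T\cup\partial\mathbb T\) the topology generated by the cones \(\{z : y \text{ lies on the geodesic from } x \text{ to } z\}\), \(x,y\in\mathbb T\). Fix an end \(\omega\in\partial\mathbb T\) and a vertex \(o\). For vertices \(x,y\) let \(x\wedge y\) be the first common vertex of the geodesics from \(x\) to \(\omega\) and from \(y\) to \(\omega\), and let \(\phi(x)=d(x,x\wedge o)-d(o,x\wedge o)\). Let \(\mathrm{Aff}(\mathbb T)\) be the group of isometries of \((\mathbb T,d)\) that fix \(\omega\), with the topology of pointwise convergence on \(\mathbb T\) and its Borel \(\sigma\)-algebra, and for \(g\in\mathrm{Aff}(\mathbb T)\) put \(\phi(g)=\phi(go)\) and \(|g|=d(go,o)\). Let \(\mu\) be a Borel probability measure on \(\mathrm{Aff}(\mathbb T)\), and let \(\Gamma\) be the closed subgroup generated by its support. Assume that \(\Gamma\) is non-exceptional, i.e. \(\Gamma\) is not contained in \(\mathrm{Hor}(\mathbb T)=\{g\in\mathrm{Aff}(\mathbb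 T) : \phi(gx)=\phi(x)\ \text{for all } x\in\mathbb T\}\) and \(\Gamma\) fixes no end in \(\partial\mathbb T\setminus\{\omega\}\), and that \(\phi(\Gamma)=\mathbb Z\). Let \(X_1,X_2,\dots\) be independent \(\mathrm{Aff}(\mathbb T)\)-valued random variables with law \(\mu\), and let \(R_0=e\), \(R_n=X_1X_2\cdots X_n\) be the right random walk. If \(\mathbb E|X_1|<\infty\) and \(\mu(\phi)=\int\phi\,d\mu=0\), then \(R_n\to\omega\) almost surely, that is, almost surely \(R_nx\to\omega\) in \(\mathbb T\cup\partial\mathbb T\) for every vertex \(x\in\mathbb T\). -/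

import Mathlib

open MeasureTheory ProbabilityTheory Filter Topology

namespace OrientedTree

variable {V : Type*}

/-- A geodesic ray of the graph `G`: a sequence of vertices along which the graph distance
is the difference of the indices. -/
structure Ray (G : SimpleGraph V) where
  toFun : ℕ → V
  dist_eq : ∀ m n : ℕ, m ≤ n → G.dist (toFun m) (toFun n) = n - m

/-- Two geodesic rays are equivalent if they coincide but for finitely many vertices. -/
def raySetoid (G : SimpleGraph V) : Setoid (Ray G) where
  r γ δ := ∃ k l : ℕ, ∀ n : ℕ, γ.toFun (n + k) = δ.toFun (n + l)
  iseqv :=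
    { refl := fun _ => ⟨0, 0, fun _ => rfl⟩
      symm := fun ⟨k, l, h⟩ => ⟨l, k, fun n => (h n).symm⟩
      trans := by
        rintro γ δ ε ⟨k, l, h⟩ ⟨k', l', h'⟩
        refine ⟨k' + k, l + l', fun n => ?_⟩
        have e1 := h (n + k')
        have e2 := h' (n + l)
        rw [show n + (k' + k) = n + k' + k by ring, e1,
          show n + k' + l = n + l + k' by ring, e2,
          show n + (l + l') = n + l + l' by ring] }

/-- The boundary of the tree: its ends, i.e. the equivalence classes of geodesic rays. -/
def Boundary (G : SimpleGraph V) : Type _ := Quotient (raySetoid G)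

/-- The end represented by a geodesic ray. -/
def Ray.toEnd {G : SimpleGraph V} (γ : Ray G) : Boundary G := Quotient.mk (raySetoid G) γ

/-- The union of the tree and its boundary. -/
inductive Compactification (G : SimpleGraph V)
  | vertex (x : V) : Compactification G
  | boundary (ξ : Boundary G) : Compactification G

/-- The cone at `y` seen from `x`: all the vertices and ends `z` such that the geodesic
from `x` to `z` passes through `y`. -/
def cone (G : SimpleGraph V) (x y : V) : Set (Compactification G) :=
  {p | match p with
    | .vertex z => G.dist x y + G.dist y z = G.dist x z
    | .boundary ξ => ∃ γ : Ray G, γ.toFun 0 = x ∧ γ.toEnd = ξ ∧ ∃ n, γ.toFun n = y}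

/-- The topology of the cones on the union of the tree and its boundary. -/
instance (G : SimpleGraph V) : TopologicalSpace (Compactification G) :=
  TopologicalSpace.generateFrom {U | ∃ x y : V, U = cone G x y}

section Busemann

variable (G : SimpleGraph V) (ω : Boundary G)

/-- From every vertex of a connected graph starts a geodesic ray in the class of a given end. -/
theorem exists_ray_from {G : SimpleGraph V} (hG : G.Connected) (ω : Boundary G) (x : V) :
    ∃ γ : Ray G, γ.toFun 0 = x ∧ γ.toEnd = ω := by
  obtain ⟨γ, rfl⟩ : ∃ γ : Ray G, γ.toEnd = ω := Quotient.exists_rep ω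
  have step : ∀ k, G.dist (γ.toFun k) (γ.toFun (k + 1)) = 1 := fun k => by
    rw [γ.dist_eq _ _ (Nat.le_succ k)]; omega
  -- choose `N` minimising `d(x, γ n) - n`
  obtain ⟨N, hN⟩ : ∃ N, ∀ k, G.dist x (γ.toFun (N + k)) = G.dist x (γ.toFun N) + k := by
    let f : ℕ → ℕ := fun n => G.dist x (γ.toFun n) + G.dist x (γ.toFun 0) - n
    have hlow : ∀ n, n ≤ G.dist x (γ.toFun n) + G.dist x (γ.toFun 0) := fun n => by
      have h1 := γ.dist_eq 0 n (Nat.zero_le n)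
      have h2 := hG.dist_triangle (u := γ.toFun 0) (v := x) (w := γ.toFun n)
      rw [G.dist_comm (u := γ.toFun 0) (v := x)] at h2
      omega
    obtain ⟨N, hN⟩ : ∃ N, ∀ n, f N ≤ f n := by
      exact ⟨Function.argmin f, fun n => Function.argmin_le f n⟩
    refine ⟨N, fun k => ?_⟩
    have h1 := hN (N + k)
    have h2 := hlow N
    have h3 := hlow (N + k)
    have h4 := hG.dist_triangle (u := x) (v := γ.toFun N) (w := γ.toFun (N + k))
    rw [γ.dist_eq N (N + k) (Nat.le_add_right N k)] at h4
    simp only [f] at h1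
    omega
  obtain ⟨p, hp⟩ := hG.exists_walk_length_eq_dist x (γ.toFun N)
  set D := G.dist x (γ.toFun N) with hD
  let c : ℕ → V := fun i => if i ≤ D then p.getVert i else γ.toFun (N + (i - D))
  have hcD : ∀ k, c (k + D) = γ.toFun (k + N) := by
    intro k
    by_cases hk : k = 0
    · subst hk
      simp only [c, zero_add, le_refl, if_true]
      rw [← hp, p.getVert_length]
    · simp only [c]
      rw [if_neg (by omega), show N + (k + D - D) = k + N by omega]
  have hc0 : c 0 = x := by simp [c]
  have hstep : ∀ i, G.dist (c i) (c (i + 1)) ≤ 1 := by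
    intro i
    by_cases hi : i < D
    · have : c i = p.getVert i ∧ c (i + 1) = p.getVert (i + 1) := by
        simp only [c]
        rw [if_pos (by omega), if_pos (by omega)]
        exact ⟨rfl, rfl⟩
      rw [this.1, this.2]
      exact (SimpleGraph.dist_eq_one_iff_adj.2 (p.adj_getVert_succ (by omega))).le
    · obtain ⟨k, rfl⟩ : ∃ k, i = k + D := ⟨i - D, by omega⟩
      rw [hcD, show k + D + 1 = (k + 1) + D by ring, hcD,
        show k + 1 + N = k + N + 1 by ring, step]
  have hlip : ∀ i k, G.dist (c i) (c (i + k)) ≤ k := by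
    intro i k
    induction k with
    | zero => simp
    | succ k ih =>
      have h1 := hG.dist_triangle (u := c i) (v := c (i + k)) (w := c (i + k + 1))
      have h2 := hstep (i + k)
      rw [← add_assoc]
      omega
  have hfar : ∀ k, G.dist x (c (k + D)) = k + D := fun k => by
    rw [hcD, add_comm k N, hN]; ring
  have hx : ∀ i, G.dist x (c i) = i := by
    intro i
    have h1 := hlip 0 i
    rw [zero_add, hc0] at h1
    have h2 := hlip i D
    have h3 := hfar i
    have h4 := hG.dist_triangle (u := x) (v := c i) (w := c (i + D))
    omega
  refine ⟨⟨c, fun m n hmn => ?_⟩, hc0, Quotient.sound ⟨D, N, hcD⟩⟩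
  obtain ⟨k, rfl⟩ := Nat.exists_eq_add_of_le hmn
  have h1 := hlip m k
  have h2 := hG.dist_triangle (u := x) (v := c m) (w := c (m + k))
  rw [hx, hx] at h2
  omega

open Classical in
/-- The geodesic starting at `x` and in the class of the end `ω`, as a sequence of vertices
(it exists by `exists_ray_from`, and it is unique when `G` is a tree). -/
noncomputable def geodesicTo (x : V) : ℕ → V :=
  if h : ∃ γ : Ray G, γ.toFun 0 = x ∧ γ.toEnd = ω then h.choose.toFun else fun _ => x

/-- The meet `x ∧ y`: the first vertex of the geodesic from `x` to `ω` that lies on the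
geodesic from `y` to `ω`. -/
noncomputable def meet (x y : V) : V :=
  geodesicTo G ω x (sInf {n | geodesicTo G ω x n ∈ Set.range (geodesicTo G ω y)})

/-- The height (Busemann) function `φ(x) = d(x, x ∧ o) - d(o, x ∧ o)` with origin `o`. -/
noncomputable def height (o x : V) : ℤ :=
  (G.dist x (meet G ω x o) : ℤ) - (G.dist o (meet G ω x o) : ℤ)

end Busemann

/-- The group of isometries of the vertex set with the graph distance. -/
def isoGroup (G : SimpleGraph V) : Subgroup (Equiv.Perm V) where
  carrier := {g | ∀ x y, G.dist (g x) (g y) = G.dist x y}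
  one_mem' := fun _ _ => rfl
  mul_mem' := fun {a b} ha hb x y => by
    simp only [Set.mem_ofPred_eq] at ha hb
    rw [Equiv.Perm.mul_apply, Equiv.Perm.mul_apply, ha, hb]
  inv_mem' := fun {a} ha x y => by
    simp only [Set.mem_ofPred_eq] at ha
    rw [← ha]
    simp

/-- The image of a geodesic ray under an isometry. -/
def Ray.map {G : SimpleGraph V} (g : isoGroup G) (γ : Ray G) : Ray G where
  toFun n := g.1 (γ.toFun n)
  dist_eq m n h := by rw [g.2, γ.dist_eq m n h]

/-- The action of the isometries on the boundary, through their action on the rays. -/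
instance (G : SimpleGraph V) : MulAction (isoGroup G) (Boundary G) where
  smul g := Quotient.map (sa := raySetoid G) (sb := raySetoid G) (Ray.map g)
    fun _ _ ⟨k, l, h⟩ => ⟨k, l, fun n => congrArg g.1 (h n)⟩
  one_smul ξ := by
    induction ξ using Quotient.inductionOn
    rfl
  mul_smul g h ξ := by
    induction ξ using Quotient.inductionOn
    rfl

/-- The topology of pointwise convergence on the (discrete) vertex set. -/
instance (G : SimpleGraph V) : TopologicalSpace (isoGroup G) :=
  TopologicalSpace.induced (fun g x => g.1 x) (@Pi.topologicalSpace V (fun _ => V) fun _ => ⊥)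

theorem continuous_isoGroup_iff {G : SimpleGraph V} {Y : Type*} [TopologicalSpace Y]
    {f : Y → isoGroup G} :
    Continuous f ↔ ∀ x y : V, IsOpen {t | (f t).1 x = y} := by
  let _ : TopologicalSpace V := ⊥
  have _ : DiscreteTopology V := ⟨rfl⟩
  rw [continuous_induced_rng, continuous_pi_iff]
  refine forall_congr' fun x => ?_
  rw [continuous_discrete_rng]
  rfl

theorem isOpen_setOf_apply_eq {G : SimpleGraph V} (x y : V) :
    IsOpen {g : isoGroup G | g.1 x = y} :=
  continuous_isoGroup_iff.1 (continuous_id (X := isoGroup G)) x y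

instance (G : SimpleGraph V) : IsTopologicalGroup (isoGroup G) where
  continuous_mul := by
    rw [continuous_isoGroup_iff]
    intro x y
    have : {t : isoGroup G × isoGroup G | (t.1 * t.2).1 x = y} =
        ⋃ z : V, {g : isoGroup G | g.1 z = y} ×ˢ {g : isoGroup G | g.1 x = z} := by
      ext t
      simp
    rw [this]
    exact isOpen_iUnion fun z => (isOpen_setOf_apply_eq z y).prod (isOpen_setOf_apply_eq x z)
  continuous_inv := by
    rw [continuous_isoGroup_iff]
    intro x y
    have : {g : isoGroup G | (g⁻¹).1 x = y} = {g : isoGroup G | g.1 y = x} := by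
      ext g
      simp only [Set.mem_ofPred_eq, Subgroup.coe_inv]
      rw [Equiv.Perm.inv_eq_iff_eq]
      exact eq_comm
    rw [this]
    exact isOpen_setOf_apply_eq y x

instance (G : SimpleGraph V) : MeasurableSpace (isoGroup G) := borel _

instance (G : SimpleGraph V) : BorelSpace (isoGroup G) := ⟨rfl⟩

/-- The affine group of the tree: the isometries that fix the end `ω`. It carries the
subspace topology, i.e. that of pointwise convergence, and the Borel sets. -/
abbrev Aff (G : SimpleGraph V) (ω : Boundary G) : Subgroup (isoGroup G) :=
  MulAction.stabilizer (isoGroup G) ω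

section Affine

variable {G : SimpleGraph V} {ω : Boundary G}

/-- The image of a vertex under an affinity. -/
def act (g : Aff G ω) (x : V) : V := g.1.1 x

/-- The homomorphism `φ` from the affine group to `ℤ`, `φ(g) = φ(g o)`. -/
noncomputable def phi (o : V) (g : Aff G ω) : ℤ := height G ω o (act g o)

/-- The semi-norm `|g| = d(g o, o)`. -/
noncomputable def seminorm (o : V) (g : Aff G ω) : ℕ := G.dist (act g o) o

/-- The closed subgroup generated by the support of `μ`. -/
noncomputable def closedGroup (μ : Measure (Aff G ω)) : Subgroup (Aff G ω) :=
  (Subgroup.closure μ.support).topologicalClosure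

/-- A subgroup of the affine group is non-exceptional if it is not contained in the horocyclic
group (the affinities that preserve the height) and fixes no end other than `ω`. -/
def NonExceptional (o : V) (Γ : Subgroup (Aff G ω)) : Prop :=
  (¬ ∀ g ∈ Γ, ∀ x : V, height G ω o (act g x) = height G ω o x) ∧
    ∀ ξ : Boundary G, ξ ≠ ω → ∃ g ∈ Γ, g.1 • ξ ≠ ξ

/-- The right random walk with increments `X 0, X 1, …`: the identity at time `0` and the
product `X 0 * X 1 * ⋯ * X (n - 1)` at time `n`. -/
def rightWalk {Ω : Type*} (X : ℕ → Ω → Aff G ω) : ℕ → Ω → Aff G ω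
  | 0, _ => 1
  | n + 1, w => rightWalk X n w * X n w

/-- A sequence of affinities converges to the end `β` if `g n x` converges to `β`, in the
union of the tree and its boundary, for all vertices `x`. -/
def ConvergesToEnd (g : ℕ → Aff G ω) (β : Boundary G) : Prop :=
  ∀ x : V, Tendsto (fun n => Compactification.vertex (G := G) (act (g n) x)) atTop
    (𝓝 (Compactification.boundary β))

end Affine

end OrientedTree

/-! Fixing `ω` gives each vertex a `parent`, its neighbour towards `ω`, and the affine group
commutes with `parent`. So the walk from `x` is at depth `k` below `v` exactly when the walk from
the `k`-th ancestor of `x` is at `v`: one bound on the Green function at `v` controls every depth.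

Transience (`exists_green_le`): an element of `closedGroup μ` with `phi` equal to `-1` translates an
axis one step towards `ω`. If the Green function at a vertex `v` of the axis diverged, it would be
asymptotically equal to its diagonal value on the whole orbit of `v`
(`attained_of_mem_closedGroup`). Distinct vertices of one generation below `v` must share that
diagonal value (`green_add_green_le`), so the orbit would have at most one vertex per generation,
hence lie on the axis, and the group would fix the second end of the axis.

Convergence: it suffices to leave the descendants of each axis vertex for good. An exit from depth
`k` needs a jump longer than `k`, so transience and the first moment make the expected number of
exits finite (`ae_eventually_mem_descendants_of_mem`). Staying inside for ever is impossible
(`ae_frequently_notMem_descendants`): zero drift makes the depth `o(n)`, while the expected time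
spent at each depth is bounded. -/

namespace OrientedTree

/-! ### The ancestor map, heights and sets of descendants -/

section Parent

variable {V : Type*} {G : SimpleGraph V}

/-- In a tree, a vertex between `x` and `y` is determined by its distance to `x`. -/
theorem eq_of_between (hT : G.IsTree) {x y a b : V}
    (ha : G.dist x a + G.dist a y = G.dist x y) (hb : G.dist x b + G.dist b y = G.dist x y)
    (hab : G.dist x a = G.dist x b) : a = b := by
  have key : ∀ c, G.dist x c + G.dist c y = G.dist x y →
      ∃ p : G.Walk x y, p.IsPath ∧ p.getVert (G.dist x c) = c := by
    intro c hc
    obtain ⟨p, hp⟩ := hT.connected.exists_walk_length_eq_dist x c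
    obtain ⟨r, hr⟩ := hT.connected.exists_walk_length_eq_dist c y
    refine ⟨p.append r, SimpleGraph.Walk.isPath_of_length_eq_dist _ ?_, ?_⟩
    · rw [SimpleGraph.Walk.length_append, hp, hr, hc]
    · rw [SimpleGraph.Walk.getVert_append, ← hp]
      simp
  obtain ⟨p, hp, hpa⟩ := key a ha
  obtain ⟨r, hr, hrb⟩ := key b hb
  have : p = r := (hT.existsUnique_path x y).unique hp hr
  rw [← hpa, ← hrb, this, hab]

theorem Ray.dist_zero (γ : Ray G) (n : ℕ) : G.dist (γ.toFun 0) (γ.toFun n) = n := by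
  rw [γ.dist_eq 0 n (Nat.zero_le n), Nat.sub_zero]

/-- Two rays with the same origin and the same end coincide. -/
theorem Ray.ext_of_toEnd (hT : G.IsTree) {γ δ : Ray G} (h0 : γ.toFun 0 = δ.toFun 0)
    (h : γ.toEnd = δ.toEnd) (n : ℕ) : γ.toFun n = δ.toFun n := by
  obtain ⟨k, l, hkl⟩ := Quotient.exact h
  have hk : k = l := by
    have h1 := γ.dist_zero (0 + k)
    rw [hkl, h0, δ.dist_zero] at h1
    omega
  subst hk
  have h1 := hkl n
  have hγ := γ.dist_eq n (n + k) (Nat.le_add_right n k)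
  have hδ := δ.dist_eq n (n + k) (Nat.le_add_right n k)
  have hγ' := γ.dist_zero (n + k)
  have hδ' := δ.dist_zero (n + k)
  have hγn := γ.dist_zero n
  have hδn := δ.dist_zero n
  refine eq_of_between hT (x := γ.toFun 0) (y := γ.toFun (n + k)) (by omega) ?_ ?_
  · rw [h1, h0]; omega
  · rw [hγn, h0, hδn]

variable (ω : Boundary G)

/-- The geodesic ray from `x` to the end `ω`. -/
noncomputable def rayTo (hT : G.IsTree) (x : V) : Ray G :=
  (exists_ray_from hT.connected ω x).choose

variable {ω}

theorem rayTo_zero (hT : G.IsTree) (x : V) : (rayTo ω hT x).toFun 0 = x :=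
  (exists_ray_from hT.connected ω x).choose_spec.1

theorem rayTo_toEnd (hT : G.IsTree) (x : V) : (rayTo ω hT x).toEnd = ω :=
  (exists_ray_from hT.connected ω x).choose_spec.2

theorem geodesicTo_eq_rayTo (hT : G.IsTree) (x : V) :
    geodesicTo G ω x = (rayTo ω hT x).toFun := by
  have h := exists_ray_from hT.connected ω x
  rw [geodesicTo, dif_pos h, rayTo]

theorem Ray.eq_geodesicTo (hT : G.IsTree) (γ : Ray G) (h : γ.toEnd = ω) (n : ℕ) :
    γ.toFun n = geodesicTo G ω (γ.toFun 0) n := by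
  rw [geodesicTo_eq_rayTo hT]
  exact Ray.ext_of_toEnd hT (rayTo_zero hT _).symm (by rw [h, rayTo_toEnd]) n

variable (ω) in
/-- The neighbour of `x` on the geodesic from `x` to `ω`. -/
noncomputable def parent (x : V) : V := geodesicTo G ω x 1

/-- The ray `γ` without its first vertex. -/
def Ray.tail (γ : Ray G) : Ray G where
  toFun n := γ.toFun (n + 1)
  dist_eq m n h := by rw [γ.dist_eq _ _ (by omega)]; omega

theorem Ray.tail_toEnd (γ : Ray G) : γ.tail.toEnd = γ.toEnd :=
  Quotient.sound ⟨0, 1, fun _ => rfl⟩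

theorem Ray.eq_parent_iterate (hT : G.IsTree) (γ : Ray G) (h : γ.toEnd = ω) (n : ℕ) :
    γ.toFun n = (parent ω)^[n] (γ.toFun 0) := by
  induction n generalizing γ with
  | zero => rfl
  | succ n ih =>
    rw [Function.iterate_succ_apply, parent, ← γ.eq_geodesicTo hT h 1]
    exact ih γ.tail (γ.tail_toEnd.trans h)

theorem geodesicTo_eq_parent_iterate (hT : G.IsTree) (x : V) (n : ℕ) :
    geodesicTo G ω x n = (parent ω)^[n] x := by
  rw [geodesicTo_eq_rayTo hT, (rayTo ω hT x).eq_parent_iterate hT (rayTo_toEnd hT x),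
    rayTo_zero]

theorem dist_parent_iterate (hT : G.IsTree) (x : V) (n : ℕ) :
    G.dist x ((parent ω)^[n] x) = n := by
  have h := (rayTo ω hT x).dist_zero n
  rwa [(rayTo ω hT x).eq_parent_iterate hT (rayTo_toEnd hT x) n, rayTo_zero] at h

theorem adj_parent (hT : G.IsTree) (x : V) : G.Adj x (parent ω x) :=
  SimpleGraph.dist_eq_one_iff_adj.1 (dist_parent_iterate hT x 1)

theorem parent_iterate_injective (hT : G.IsTree) (x : V) :
    Function.Injective fun n => (parent ω)^[n] x := fun m n h => by
  have h1 := congrArg (G.dist x) h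
  simpa only [dist_parent_iterate hT] using h1

/-- Of two adjacent vertices, one is the parent of the other. -/
theorem parent_eq_or_eq_parent (hT : G.IsTree) {x y : V} (hxy : G.Adj x y) :
    parent ω x = y ∨ parent ω y = x := by
  have aux : ∀ {x y z : V} {n : ℕ}, G.Adj x y → (parent ω)^[n] x = z →
      G.dist x z = G.dist y z + 1 → parent ω x = y := by
    intro x y z n hxy hz hd
    have hn := dist_parent_iterate (ω := ω) hT x n
    rw [hz] at hn
    obtain ⟨m, rfl⟩ : ∃ m, n = m + 1 := ⟨n - 1, by omega⟩
    have h1 := dist_parent_iterate (ω := ω) hT (parent ω x) m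
    rw [← Function.iterate_succ_apply, hz] at h1
    have h2 : G.dist x (parent ω x) = 1 := SimpleGraph.dist_eq_one_iff_adj.2 (adj_parent hT x)
    have h3 : G.dist x y = 1 := SimpleGraph.dist_eq_one_iff_adj.2 hxy
    exact eq_of_between hT (x := x) (y := z) (by omega) (by omega) (by omega)
  obtain ⟨k, l, h⟩ : ∃ k l, (parent ω)^[k] x = (parent ω)^[l] y := by
    obtain ⟨k, l, hkl⟩ := Quotient.exact ((rayTo_toEnd hT x).trans (rayTo_toEnd (ω := ω) hT y).symm)
    refine ⟨k, l, ?_⟩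
    have h0 := hkl 0
    rwa [← geodesicTo_eq_rayTo, ← geodesicTo_eq_rayTo, geodesicTo_eq_parent_iterate hT,
      geodesicTo_eq_parent_iterate hT, zero_add, zero_add] at h0
  -- The distances of `x` and `y` to a common ancestor differ by exactly one; the nearer vertex is
  -- then the first step from the other one towards that ancestor.
  have h1 := hT.dist_eq_dist_add_one_of_adj ((parent ω)^[k] x) hxy
  rw [SimpleGraph.dist_comm (v := x), SimpleGraph.dist_comm (v := y)] at h1
  rcases h1 with h1 | h1
  · exact .inl (aux hxy rfl h1)
  · exact .inr (aux hxy.symm h.symm h1)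

theorem dist_le_add (hT : G.IsTree) {x y : V} {a b : ℕ}
    (h : (parent ω)^[a] x = (parent ω)^[b] y) : G.dist x y ≤ a + b := by
  have h1 := hT.connected.dist_triangle (u := x) (v := (parent ω)^[a] x) (w := y)
  rw [dist_parent_iterate hT, h, SimpleGraph.dist_comm (u := (parent ω)^[b] y),
    dist_parent_iterate hT] at h1
  exact h1

/-- The geodesic between two vertices ascends and then descends. -/
theorem exists_iterate_eq_iterate (hT : G.IsTree) (x y : V) :
    ∃ a b, a + b = G.dist x y ∧ (parent ω)^[a] x = (parent ω)^[b] y := by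
  suffices H : ∀ {x y : V} (p : G.Walk x y),
      ∃ a b, a + b ≤ p.length ∧ (parent ω)^[a] x = (parent ω)^[b] y by
    obtain ⟨p, hp⟩ := hT.connected.exists_walk_length_eq_dist x y
    obtain ⟨a, b, hab, h⟩ := H p
    exact ⟨a, b, le_antisymm (hab.trans hp.le) (dist_le_add hT h), h⟩
  intro x y p
  induction p with
  | nil => exact ⟨0, 0, by simp, rfl⟩
  | @cons u v w hadj p ih =>
    obtain ⟨a, b, hab, h⟩ := ih
    rw [SimpleGraph.Walk.length_cons]
    rcases parent_eq_or_eq_parent (ω := ω) hT hadj with h1 | h1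
    · refine ⟨a + 1, b, by omega, ?_⟩
      rw [Function.iterate_succ_apply, h1, h]
    -- The first edge descends from `u` to its child `v`. If the remaining path ascends, the two
    -- steps cancel.
    · cases a with
      | zero =>
        refine ⟨0, b + 1, by omega, ?_⟩
        rw [Function.iterate_succ_apply', ← h]
        exact h1.symm
      | succ a =>
        refine ⟨a, b, by omega, ?_⟩
        rw [← h, Function.iterate_succ_apply, h1]

/-- An isometry fixing `ω` carries the ray from `x` to `ω` to a ray in the same end, and such rays
are unique given their origin. -/
theorem parent_act (hT : G.IsTree) (g : Aff G ω) (x : V) :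
    parent ω (act g x) = act g (parent ω x) := by
  let γ := Ray.map g.1 (rayTo ω hT x)
  have hend : γ.toEnd = ω := by
    have h1 : γ.toEnd = g.1 • (rayTo ω hT x).toEnd := rfl
    rw [h1, rayTo_toEnd]
    exact g.2
  have h := γ.eq_parent_iterate hT hend 1
  have h0 : γ.toFun 0 = act g x := congrArg g.1.1 (rayTo_zero hT x)
  rw [h0] at h
  rw [parent, parent, geodesicTo_eq_rayTo hT x]
  rw [← geodesicTo_eq_parent_iterate hT] at h
  exact h.symm

theorem parent_iterate_act (hT : G.IsTree) (g : Aff G ω) (n : ℕ) (x : V) :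
    (parent ω)^[n] (act g x) = act g ((parent ω)^[n] x) :=
  ((Function.Semiconj.iterate_right (f := act g) (fun y => (parent_act hT g y).symm) n) x).symm

theorem sub_eq_sub_of_iterate_eq (hT : G.IsTree) {x y : V} {a b c d : ℕ}
    (h : (parent ω)^[a] x = (parent ω)^[b] y) (h' : (parent ω)^[c] x = (parent ω)^[d] y) :
    (a : ℤ) - b = c - d := by
  have e : (parent ω)^[c + b] y = (parent ω)^[a + d] y := by
    rw [Function.iterate_add_apply, ← h, ← Function.iterate_add_apply, Nat.add_comm c a,
      Function.iterate_add_apply, h', ← Function.iterate_add_apply]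
  have := parent_iterate_injective hT y e
  omega

/-- Any common ancestor gives the same difference, since the successive ancestors of a vertex are
distinct. The meet never has to be located afterwards. -/
theorem height_eq (hT : G.IsTree) {o x : V} {a b : ℕ}
    (h : (parent ω)^[a] x = (parent ω)^[b] o) : height G ω o x = a - b := by
  have hne : {n | geodesicTo G ω x n ∈ Set.range (geodesicTo G ω o)}.Nonempty :=
    ⟨a, b, by rw [geodesicTo_eq_parent_iterate hT, geodesicTo_eq_parent_iterate hT, h]⟩
  obtain ⟨d, hd⟩ := Nat.sInf_mem hne
  set c := sInf {n | geodesicTo G ω x n ∈ Set.range (geodesicTo G ω o)} with hc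
  have hm : meet G ω x o = geodesicTo G ω x c := rfl
  rw [geodesicTo_eq_parent_iterate hT] at hm
  rw [geodesicTo_eq_parent_iterate hT, geodesicTo_eq_parent_iterate hT] at hd
  rw [height, hm, dist_parent_iterate hT, ← hd, dist_parent_iterate hT]
  exact (sub_eq_sub_of_iterate_eq hT h hd.symm).symm

theorem height_parent_iterate (hT : G.IsTree) (o x : V) (n : ℕ) :
    height G ω o ((parent ω)^[n] x) = height G ω o x - n := by
  obtain ⟨a, b, -, h⟩ := exists_iterate_eq_iterate (ω := ω) hT x o
  rw [height_eq hT h, height_eq hT (a := a) (b := b + n)]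
  · push_cast; ring
  · rw [← Function.iterate_add_apply, Nat.add_comm a n, Function.iterate_add_apply, h,
      ← Function.iterate_add_apply, Nat.add_comm]

theorem height_act (hT : G.IsTree) (o x : V) (g : Aff G ω) :
    height G ω o (act g x) = height G ω o x + phi o g := by
  obtain ⟨a, b, -, h⟩ := exists_iterate_eq_iterate (ω := ω) hT x o
  obtain ⟨c, d, -, h'⟩ := exists_iterate_eq_iterate (ω := ω) hT (act g o) o
  rw [phi, height_eq hT h, height_eq hT h', height_eq hT (a := a + c) (b := d + b)]
  · push_cast; ring
  · rw [Nat.add_comm a c, Function.iterate_add_apply, parent_iterate_act hT, h,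
      ← parent_iterate_act hT, ← Function.iterate_add_apply, Nat.add_comm c b,
      Function.iterate_add_apply, h', ← Function.iterate_add_apply, Nat.add_comm b d]

theorem abs_phi_le (hT : G.IsTree) (o : V) (g : Aff G ω) : |phi o g| ≤ seminorm o g := by
  obtain ⟨a, b, hab, h⟩ := exists_iterate_eq_iterate (ω := ω) hT (act g o) o
  rw [phi, seminorm, height_eq hT h, ← hab, abs_le]
  push_cast
  constructor <;> omega

theorem finite_parent_iterate_eq [G.LocallyFinite] (hT : G.IsTree) (n : ℕ) (v : V) :
    {x | (parent ω)^[n] x = v}.Finite := by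
  induction n with
  | zero => simp
  | succ n ih =>
    have hfin : (⋃ u ∈ {x | (parent ω)^[n] x = v}, G.neighborSet u).Finite :=
      ih.biUnion fun u _ => Set.toFinite _
    refine hfin.subset fun x hx => ?_
    simp only [Set.mem_iUnion]
    exact ⟨parent ω x, hx, (adj_parent hT x).symm⟩

theorem countable_of_isTree [G.LocallyFinite] (hT : G.IsTree) (ω : Boundary G) : Countable V := by
  obtain ⟨o⟩ := hT.connected.nonempty
  refine Set.countable_univ_iff.1 (Set.Countable.mono (s₂ := ⋃ a : ℕ, ⋃ b : ℕ,
    {x | (parent ω)^[a] x = (parent ω)^[b] o}) (fun x _ => ?_) ?_)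
  · obtain ⟨a, b, -, h⟩ := exists_iterate_eq_iterate (ω := ω) hT x o
    simp only [Set.mem_iUnion]
    exact ⟨a, b, h⟩
  · exact Set.countable_iUnion fun a => Set.countable_iUnion fun b =>
      (finite_parent_iterate_eq hT a _).countable

variable (ω) in
/-- The descendants of `v`: the vertices whose geodesic to `ω` passes through `v`. -/
def descendants (v : V) : Set V := {x | ∃ k, (parent ω)^[k] x = v}

theorem descendants_subset (v : V) (n : ℕ) :
    descendants ω v ⊆ descendants ω ((parent ω)^[n] v) := by
  rintro x ⟨k, rfl⟩
  exact ⟨n + k, Function.iterate_add_apply _ _ _ _⟩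

/-- A step out of the set of descendants of `v` is longer than the depth of its origin. -/
theorem lt_dist_of_notMem_descendants (hT : G.IsTree) {v x y : V} {k : ℕ}
    (hx : (parent ω)^[k] x = v) (hy : y ∉ descendants ω v) : k < G.dist x y := by
  by_contra! hk
  obtain ⟨a, b, hab, h⟩ := exists_iterate_eq_iterate (ω := ω) hT x y
  -- Here `a ≤ k`: from `y`, climb `b` steps to the `a`-th ancestor of `x`, then `k - a` more to
  -- `v`.
  refine hy ⟨(k - a) + b, ?_⟩
  rw [Function.iterate_add_apply, ← h, ← Function.iterate_add_apply, ← hx]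
  congr 1
  omega

/-- A sequence of vertices converges to `ω` if it leaves every set of descendants. -/
theorem tendsto_boundary (hT : G.IsTree) {z : ℕ → V}
    (h : ∀ v, ∀ᶠ n in atTop, z n ∉ descendants ω v) :
    Tendsto (fun n => Compactification.vertex (G := G) (z n)) atTop
      (𝓝 (Compactification.boundary ω)) := by
  rw [TopologicalSpace.tendsto_nhds_generateFrom_iff]
  rintro U ⟨x, y, rfl⟩ ⟨γ, h0, hγ, n, hn⟩
  have hy : (parent ω)^[n] x = y := by rw [← hn, γ.eq_parent_iterate hT hγ, h0]
  -- A geodesic from `x` that turns down before reaching `y` ends below the ancestor just before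
  -- `y`. For `n = 0` the truncated index is harmless, as `n ≤ a` is automatic.
  filter_upwards [h ((parent ω)^[n - 1] x)] with m hm
  change G.dist x y + G.dist y (z m) = G.dist x (z m)
  obtain ⟨a, b, hab, e⟩ := exists_iterate_eq_iterate (ω := ω) hT x (z m)
  have hna : n ≤ a := by
    by_contra! hlt
    refine hm ⟨(n - 1 - a) + b, ?_⟩
    rw [Function.iterate_add_apply, ← e, ← Function.iterate_add_apply]
    congr 1
    omega
  have h1 : G.dist y (z m) ≤ (a - n) + b := by
    refine dist_le_add (ω := ω) hT ?_
    rw [← hy, ← Function.iterate_add_apply, Nat.sub_add_cancel hna, e]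
  have h2 := dist_parent_iterate (ω := ω) hT x n
  rw [hy] at h2
  have h3 := hT.connected.dist_triangle (u := x) (v := y) (w := z m)
  omega

end Parent

/-! ### Convolution powers, Green function and maximum principles -/

section Transition

open scoped ENNReal

variable {V : Type*} {G : SimpleGraph V} {ω : Boundary G}

theorem act_mul (g h : Aff G ω) (x : V) : act (g * h) x = act g (act h x) := rfl

theorem act_one (x : V) : act (1 : Aff G ω) x = x := rfl

theorem act_inv_act (g : Aff G ω) (x : V) : act g⁻¹ (act g x) = x := by
  rw [← act_mul, inv_mul_cancel, act_one]

theorem act_act_inv (g : Aff G ω) (x : V) : act g (act g⁻¹ x) = x := by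
  rw [← act_mul, mul_inv_cancel, act_one]

theorem act_injective (g : Aff G ω) : Function.Injective (act g) := fun x y h => by
  rw [← act_inv_act g x, h, act_inv_act]

theorem act_eq_iff (g : Aff G ω) (x y : V) : act g x = y ↔ x = act g⁻¹ y :=
  ⟨fun h => by rw [← h, act_inv_act], fun h => by rw [h, act_act_inv]⟩

theorem dist_act_act (g : Aff G ω) (x y : V) : G.dist (act g x) (act g y) = G.dist x y :=
  g.1.2 x y

theorem isOpen_setOf_act_mem (x : V) (s : Set V) : IsOpen {g : Aff G ω | act g x ∈ s} := by
  have : {g : Aff G ω | act g x ∈ s} =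
      ⋃ y ∈ s, Subtype.val ⁻¹' {g : isoGroup G | g.1 x = y} := by
    ext g; simp [act]
  rw [this]
  exact isOpen_biUnion fun y _ => (isOpen_setOf_apply_eq x y).preimage continuous_subtype_val

theorem measurable_comp_act {β : Type*} [MeasurableSpace β] (F : V → β) (x : V) :
    Measurable fun g : Aff G ω => F (act g x) :=
  fun s _ => (isOpen_setOf_act_mem x (F ⁻¹' s)).measurableSet

theorem measurable_comp_act_inv {β : Type*} [MeasurableSpace β] (F : V → β) (x : V) :
    Measurable fun g : Aff G ω => F (act g⁻¹ x) :=
  fun s _ => ((isOpen_setOf_act_mem x (F ⁻¹' s)).preimage continuous_inv).measurableSet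

theorem measurableSet_act_eq (x y : V) : MeasurableSet {g : Aff G ω | act g x = y} :=
  (isOpen_setOf_act_mem x {y}).measurableSet

/-- A sequence of affinities converges to `g` if it eventually agrees with `g` at every vertex. -/
theorem tendsto_of_eventually_act_eq {u : ℕ → Aff G ω} {g : Aff G ω}
    (h : ∀ x, ∀ᶠ n in atTop, act (u n) x = act g x) : Tendsto u atTop (𝓝 g) := by
  rw [tendsto_subtype_rng]
  let _ : TopologicalSpace V := ⊥
  refine (Topology.IsInducing.mk rfl : Topology.IsInducing
    (fun (g : isoGroup G) (x : V) => g.1 x)).tendsto_nhds_iff.2 ?_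
  rw [tendsto_pi_nhds]
  exact fun x => (tendsto_congr' (h x)).2 tendsto_const_nhds

instance [Countable V] : SecondCountableTopology (isoGroup G) := by
  let _ : TopologicalSpace V := ⊥
  have _ : DiscreteTopology V := ⟨rfl⟩
  exact (Topology.IsInducing.mk rfl : Topology.IsInducing
    (fun (g : isoGroup G) (x : V) => g.1 x)).secondCountableTopology

instance [Countable V] : SecondCountableTopology (Aff G ω) :=
  (Topology.IsInducing.subtypeVal (t := (Aff G ω : Set (isoGroup G)))).secondCountableTopology

/-- The law of the random walk at time `n`: the `n`-fold convolution power of `μ`. -/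
noncomputable def convPow (μ : Measure (Aff G ω)) : ℕ → Measure (Aff G ω)
  | 0 => Measure.dirac 1
  | n + 1 => convPow μ n ∗ₘ μ

/-- The probability that the walk at time `n` moves `x` to `y`. -/
noncomputable def transition (μ : Measure (Aff G ω)) (n : ℕ) (x y : V) : ℝ≥0∞ :=
  convPow μ n {g | act g x = y}

theorem transition_zero_of_ne (μ : Measure (Aff G ω)) {x y : V} (h : x ≠ y) : transition μ 0 x y = 0 := by
  rw [transition, convPow, Measure.dirac_apply' _ (measurableSet_act_eq x y)]
  exact Set.indicator_of_notMem
    (show (1 : Aff G ω) ∉ {g : Aff G ω | act g x = y} from h) _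

/-- The expected number of visits of `x` in `y` before time `N`. -/
noncomputable def green (μ : Measure (Aff G ω)) (N : ℕ) (x y : V) : ℝ≥0∞ :=
  ∑ n ∈ Finset.range N, transition μ n x y

theorem green_mono (μ : Measure (Aff G ω)) (x y : V) {M N : ℕ} (h : M ≤ N) : green μ M x y ≤ green μ N x y :=
  Finset.sum_le_sum_of_subset (Finset.range_mono h)

/-- The walk from `v` hits the `k`-th generation below `w` if and only if it moves the `k`-th
ancestor of `v` to `w`. -/
theorem convPow_parent_iterate_act (μ : Measure (Aff G ω)) (hT : G.IsTree) (n k : ℕ) (v w : V) :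
    convPow μ n {g | (parent ω)^[k] (act g v) = w} = transition μ n ((parent ω)^[k] v) w := by
  simp only [parent_iterate_act hT]
  rfl

variable [Countable V] (μ : Measure (Aff G ω)) [IsProbabilityMeasure μ]

instance isProbabilityMeasure_convPow (n : ℕ) : IsProbabilityMeasure (convPow μ n) := by
  induction n with
  | zero => exact Measure.dirac.isProbabilityMeasure
  | succ n ih => rw [convPow]; infer_instance

/-- Splitting off the left factor gives the recursion in the target vertex, splitting off the right
one that in the starting vertex; both maximum principles rest on these. -/
theorem convPow_succ' (n : ℕ) : convPow μ (n + 1) = μ ∗ₘ convPow μ n := by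
  induction n with
  | zero => simp only [convPow, Measure.dirac_one_mconv, Measure.mconv_dirac_one]
  | succ n ih => exact (congrArg (· ∗ₘ μ) ih).trans (Measure.mconv_assoc μ (convPow μ n) μ)

theorem transition_le_one (n : ℕ) (x y : V) : transition μ n x y ≤ 1 := prob_le_one

theorem mconv_apply (μ ν : Measure (Aff G ω)) [SFinite ν] {s : Set (Aff G ω)}
    (hs : MeasurableSet s) : (μ ∗ₘ ν) s = ∫⁻ g, ν {h | g * h ∈ s} ∂μ := by
  rw [← lintegral_indicator_one hs, Measure.lintegral_mconv (measurable_one.indicator hs)]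
  refine lintegral_congr fun g => ?_
  exact lintegral_indicator_one (measurable_const_mul g hs)

/-- The decomposition of the walk according to its first step. -/
theorem transition_succ (n : ℕ) (x y : V) :
    transition μ (n + 1) x y = ∫⁻ g, transition μ n x (act g⁻¹ y) ∂μ := by
  rw [transition, convPow_succ', mconv_apply _ _ (measurableSet_act_eq x y)]
  refine lintegral_congr fun g => ?_
  rw [transition]
  congr 1
  ext h
  exact act_eq_iff g _ _

/-- The decomposition of the walk according to its last step. -/
theorem transition_succ' (n : ℕ) (x y : V) :
    transition μ (n + 1) x y = ∫⁻ g, transition μ n (act g x) y ∂μ := by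
  rw [transition, convPow, ← lintegral_indicator_one (measurableSet_act_eq x y),
    Measure.mconv, lintegral_map (measurable_one.indicator (measurableSet_act_eq x y))
      measurable_mul, lintegral_prod_symm]
  · refine lintegral_congr fun g => ?_
    rw [transition, ← lintegral_indicator_one (measurableSet_act_eq _ y)]
    rfl
  · exact ((measurable_one.indicator (measurableSet_act_eq x y)).comp measurable_mul).aemeasurable

theorem green_lt_top (N : ℕ) (x y : V) : green μ N x y < ∞ :=
  ENNReal.sum_lt_top.2 fun n _ => (transition_le_one μ n x y).trans_lt ENNReal.one_lt_top

theorem green_succ (N : ℕ) (x y : V) :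
    green μ (N + 1) x y = ∫⁻ g, green μ N x (act g⁻¹ y) ∂μ + transition μ 0 x y := by
  simp only [green]
  rw [Finset.sum_range_succ', lintegral_finsetSum]
  · simp only [transition_succ]
  · exact fun n _ => measurable_comp_act_inv (transition μ n x) y

theorem green_succ' (N : ℕ) (x y : V) :
    green μ (N + 1) x y = ∫⁻ g, green μ N (act g x) y ∂μ + transition μ 0 x y := by
  simp only [green]
  rw [Finset.sum_range_succ', lintegral_finsetSum]
  · simp only [transition_succ']
  · exact fun n _ => measurable_comp_act (fun z => transition μ n z y) x

/-- The maximum principle in the second variable. -/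
theorem green_le_left (N : ℕ) (v y : V) : green μ N v y ≤ green μ N v v := by
  induction N generalizing y with
  | zero => simp [green]
  | succ N ih =>
    rcases eq_or_ne v y with rfl | h
    · exact le_rfl
    -- Off the diagonal the time-zero term vanishes, leaving a mean of values bounded by induction.
    rw [green_succ, transition_zero_of_ne μ h, add_zero]
    calc ∫⁻ g, green μ N v (act g⁻¹ y) ∂μ ≤ ∫⁻ _, green μ N v v ∂μ := lintegral_mono fun g => ih _
      _ = green μ N v v := by simp
      _ ≤ _ := green_mono μ v v (Nat.le_succ N)

/-- The maximum principle in the first variable. -/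
theorem green_le_right (N : ℕ) (x v : V) : green μ N x v ≤ green μ N v v := by
  induction N generalizing x with
  | zero => simp [green]
  | succ N ih =>
    rcases eq_or_ne x v with rfl | h
    · exact le_rfl
    rw [green_succ', transition_zero_of_ne μ h, add_zero]
    calc ∫⁻ g, green μ N (act g x) v ∂μ ≤ ∫⁻ _, green μ N v v ∂μ := lintegral_mono fun g => ih _
      _ = green μ N v v := by simp
      _ ≤ _ := green_mono μ v v (Nat.le_succ N)

/-- The duality between descendants and ancestors. -/
theorem green_add_green_le (hT : G.IsTree) (N k : ℕ) {v w y z : V} (hyz : y ≠ z)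
    (hy : (parent ω)^[k] y = w) (hz : (parent ω)^[k] z = w) :
    green μ N v y + green μ N v z ≤ green μ N w w := by
  -- At each time, moving `v` to `y` and moving `v` to `z` are disjoint events, and both move the
  -- `k`-th ancestor of `v` to `w`.
  refine le_trans ?_ (green_le_right μ N ((parent ω)^[k] v) w)
  simp only [green]
  rw [← Finset.sum_add_distrib]
  refine Finset.sum_le_sum fun n _ => ?_
  rw [← convPow_parent_iterate_act μ hT, transition, transition,
    ← measure_union _ (measurableSet_act_eq v z)]
  · refine measure_mono ?_
    rintro g (h | h)
    · rw [Set.mem_ofPred_eq] at h ⊢; rw [h, hy]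
    · rw [Set.mem_ofPred_eq] at h ⊢; rw [h, hz]
  · exact Set.disjoint_left.2 fun g h h' => hyz (Eq.trans (Eq.symm h) h')

end Transition

/-! ### Consequences of a divergent Green function -/

section Recurrence

open scoped ENNReal Pointwise

variable {V : Type*} {G : SimpleGraph V} {ω : Boundary G}

theorem act_pow_succ (k : Aff G ω) (n : ℕ) (y : V) :
    act (k ^ (n + 1)) y = act k (act (k ^ n) y) := by
  rw [pow_succ', act_mul]

/-- An affinity that fixes a vertex has finite orbits. -/
theorem exists_act_pow_eq [G.LocallyFinite] (hT : G.IsTree) {k : Aff G ω} {v : V}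
    (hk : act k v = v) (y : V) : ∃ p, 0 < p ∧ act (k ^ p) y = y := by
  obtain ⟨a, b, -, h⟩ := exists_iterate_eq_iterate (ω := ω) hT y v
  have hv : ∀ n, act (k ^ n) v = v := fun n => by
    induction n with
    | zero => rfl
    | succ n ih => rw [act_pow_succ, ih, hk]
  have hmaps : Set.MapsTo (fun n : ℕ => act (k ^ n) y) Set.univ
      {z | (parent ω)^[a] z = (parent ω)^[b] v} := fun n _ => by
    rw [Set.mem_ofPred_eq, parent_iterate_act hT, h, ← parent_iterate_act hT, hv]
  obtain ⟨i, -, j, -, hij, e⟩ := Set.infinite_univ.exists_lt_map_eq_of_mapsTo hmaps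
    (finite_parent_iterate_eq hT a _)
  refine ⟨j - i, Nat.sub_pos_of_lt hij, ?_⟩
  apply act_injective (k ^ i)
  rw [← act_mul, ← pow_add, Nat.add_sub_cancel' hij.le]
  exact e.symm

/-- The closure of a submonoid contains the inverses of its elements that fix a vertex, up to a
factor in the submonoid. -/
theorem inv_mul_mem_topologicalClosure [G.LocallyFinite] (hT : G.IsTree)
    {T : Submonoid (Aff G ω)} {k t : Aff G ω} {v : V} (hkT : k ∈ T) (htT : t ∈ T)
    (hk : act k v = v) : k⁻¹ * t ∈ T.topologicalClosure := by
  -- Orbits of `k` are finite, so `k ^ m!` eventually fixes any given vertex; hence `k ^ (m! - 1)`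
  -- tends to `k⁻¹`.
  refine mem_closure_of_tendsto (b := atTop) (f := fun m : ℕ => k ^ (m.factorial - 1) * t)
    (tendsto_of_eventually_act_eq fun x => ?_)
    (Eventually.of_forall fun m => T.mul_mem (T.pow_mem hkT _) htT)
  obtain ⟨p, hp, hpx⟩ := exists_act_pow_eq hT hk (act t x)
  filter_upwards [eventually_ge_atTop p] with m hm
  have hper : act (k ^ m.factorial) (act t x) = act t x := by
    obtain ⟨c, hc⟩ := Nat.dvd_factorial hp hm
    rw [hc, pow_mul]
    have : ∀ c, act ((k ^ p) ^ c) (act t x) = act t x := fun c => by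
      induction c with
      | zero => rfl
      | succ c ih => rw [act_pow_succ, ih, hpx]
    exact this c
  rw [act_mul, act_mul]
  apply act_injective k
  rw [← act_pow_succ, Nat.sub_add_cancel (Nat.factorial_pos m), hper, act_act_inv]

/-- If the orbit of `v` under the submonoid `T` is contained in the orbit under its inverse, then
the closure of `T` is stable under inversion. -/
theorem inv_mem_topologicalClosure [G.LocallyFinite] (hT : G.IsTree) {T : Submonoid (Aff G ω)}
    {v : V} (h : ∀ t ∈ T, ∃ t' ∈ T, act t v = act t'⁻¹ v) {g : Aff G ω}
    (hg : g ∈ T.topologicalClosure) : g⁻¹ ∈ T.topologicalClosure := by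
  have hsub : (T : Set (Aff G ω)) ⊆ Inv.inv ⁻¹' (T.topologicalClosure : Set (Aff G ω)) := by
    intro t ht
    obtain ⟨t', ht', e⟩ := h t ht
    -- The product `t' * t` fixes `v`, and `(t' * t)⁻¹ * t'` is `t⁻¹`.
    have hk : act (t' * t) v = v := by rw [act_mul, e, act_act_inv]
    have := inv_mul_mem_topologicalClosure hT (T.mul_mem ht' ht) ht' hk
    rwa [mul_inv_rev, inv_mul_cancel_right] at this
  exact closure_minimal hsub
    (T.isClosed_topologicalClosure.preimage continuous_inv) hg

theorem closedGroup_subset_topologicalClosure (μ : Measure (Aff G ω)) {T : Submonoid (Aff G ω)}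
    (hinv : ∀ g ∈ T.topologicalClosure, g⁻¹ ∈ T.topologicalClosure)
    (hsupp : ∀ g ∈ μ.support, g⁻¹ ∈ T) {g : Aff G ω} (hg : g ∈ closedGroup μ) :
    g ∈ T.topologicalClosure := by
  let Q : Subgroup (Aff G ω) := { T.topologicalClosure with inv_mem' := fun {x} hx => hinv x hx }
  have hQ : closedGroup μ ≤ Q := by
    refine Subgroup.topologicalClosure_minimal _ ?_ T.isClosed_topologicalClosure
    rw [Subgroup.closure_le]
    intro x hx
    have := hinv _ (T.le_topologicalClosure (hsupp x hx))
    rwa [inv_inv] at this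
  exact hQ hg

/-- The relative defect of the Green function at `y` tends to zero. -/
def Attained (μ : Measure (Aff G ω)) (v y : V) : Prop :=
  Tendsto (fun N => ((green μ N v v).toReal - (green μ N v y).toReal) / (green μ N v v).toReal)
    atTop (𝓝 0)

theorem attained_self {μ : Measure (Aff G ω)} (v : V) : Attained μ v v := by
  simp [Attained]

variable [Countable V] (μ : Measure (Aff G ω)) [IsProbabilityMeasure μ]

/-- The complement of the support is null, so a positive transition probability can be realised step
by step within the support. No topological closure is needed. -/
theorem exists_mem_closure_support_of_transition_ne_zero {v y : V} {n : ℕ}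
    (h : transition μ n v y ≠ 0) : ∃ s ∈ Submonoid.closure μ.support, act s v = y := by
  induction n generalizing y with
  | zero =>
    refine ⟨1, one_mem _, ?_⟩
    by_contra hne
    exact h (transition_zero_of_ne μ hne)
  | succ n ih =>
    rw [transition_succ] at h
    have hpos : ∃ g ∈ μ.support, transition μ n v (act g⁻¹ y) ≠ 0 := by
      by_contra! hall
      refine h ((lintegral_eq_zero_iff (measurable_comp_act_inv (transition μ n v) y)).2 ?_)
      filter_upwards [μ.support_mem_ae] with g hg using hall g hg
    obtain ⟨g, hg, hgy⟩ := hpos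
    obtain ⟨s, hs, e⟩ := ih hgy
    exact ⟨g * s, mul_mem (Submonoid.subset_closure hg) hs, by rw [act_mul, e, act_act_inv]⟩

/-- The first step inequality for the Green function. -/
theorem green_le_of_step (N : ℕ) (v y : V) (x : Aff G ω) :
    green μ N v y ≤ 1 + μ {g | act g⁻¹ y = act x⁻¹ y}ᶜ * green μ N v v +
      μ {g | act g⁻¹ y = act x⁻¹ y} * green μ N v (act x⁻¹ y) := by
  set W := {g : Aff G ω | act g⁻¹ y = act x⁻¹ y} with hWdef
  have hW : MeasurableSet W :=
    ((isOpen_setOf_act_mem y {act x⁻¹ y}).preimage continuous_inv).measurableSet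
  refine (green_mono μ v y (Nat.le_succ N)).trans ?_
  rw [green_succ, ← lintegral_add_compl _ hW]
  have h1 : ∫⁻ g in W, green μ N v (act g⁻¹ y) ∂μ = μ W * green μ N v (act x⁻¹ y) := by
    rw [setLIntegral_congr_fun hW (g := fun _ => green μ N v (act x⁻¹ y))
      (fun g (hg : act g⁻¹ y = act x⁻¹ y) => by simp only [hg]), setLIntegral_const, mul_comm]
  have h2 : ∫⁻ g in Wᶜ, green μ N v (act g⁻¹ y) ∂μ ≤ μ Wᶜ * green μ N v v := by
    refine (lintegral_mono fun g => green_le_left μ N v _).trans ?_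
    rw [setLIntegral_const, mul_comm]
  rw [h1]
  calc _ ≤ μ W * green μ N v (act x⁻¹ y) + μ Wᶜ * green μ N v v + 1 := by
        gcongr
        exact transition_le_one μ 0 v y
    _ = _ := by ring

theorem toReal_green_le (N : ℕ) (v y : V) :
    (green μ N v y).toReal ≤ (green μ N v v).toReal :=
  ENNReal.toReal_mono (green_lt_top μ N v v).ne (green_le_left μ N v y)

variable {μ}

/-- Up to an error of 1, the Green function at `y` is at most a mean of its values at `g⁻¹ y`, none
above the diagonal value. The event `W` has positive mass, so the defect at `x⁻¹ y` is at most that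
at `y` plus 1, divided by `μ W`; the 1 is negligible because the diagonal value diverges. -/
theorem Attained.act_inv {v y : V} (h : Attained μ v y)
    (hrec : Tendsto (fun N => (green μ N v v).toReal) atTop atTop) {x : Aff G ω}
    (hx : x ∈ μ.support) : Attained μ v (act x⁻¹ y) := by
  set W := {g : Aff G ω | act g⁻¹ y = act x⁻¹ y} with hWdef
  have hWo : IsOpen W := (isOpen_setOf_act_mem y {act x⁻¹ y}).preimage continuous_inv
  have hpos : 0 < (μ W).toReal :=
    ENNReal.toReal_pos ((Measure.mem_support_iff_forall x).1 hx W (hWo.mem_nhds rfl)).ne'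
      (measure_ne_top μ W)
  have hcompl : (μ Wᶜ).toReal = 1 - (μ W).toReal := by
    have := probReal_compl_eq_one_sub (μ := μ) hWo.measurableSet
    exact this
  have key : ∀ N, (μ W).toReal * ((green μ N v v).toReal - (green μ N v (act x⁻¹ y)).toReal) ≤
      1 + ((green μ N v v).toReal - (green μ N v y).toReal) := by
    intro N
    have hv := (green_lt_top μ N v v).ne
    have hy := (green_lt_top μ N v (act x⁻¹ y)).ne
    have h1 := ENNReal.toReal_mono (by finiteness) (green_le_of_step μ N v y x)
    rw [ENNReal.toReal_add (by finiteness) (by finiteness),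
      ENNReal.toReal_add (by finiteness) (by finiteness), ENNReal.toReal_mul, ENNReal.toReal_mul,
      ENNReal.toReal_one, ← hWdef, hcompl] at h1
    linarith
  have hlim : Tendsto (fun N => (μ W).toReal⁻¹ * ((green μ N v v).toReal⁻¹ +
      ((green μ N v v).toReal - (green μ N v y).toReal) / (green μ N v v).toReal))
      atTop (𝓝 0) := by
    have := (hrec.inv_tendsto_atTop.add h).const_mul (μ W).toReal⁻¹
    simpa using this
  refine squeeze_zero (fun N => div_nonneg (sub_nonneg.2 (toReal_green_le μ N v _))
    ENNReal.toReal_nonneg) (fun N => ?_) hlim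
  rw [inv_eq_one_div (green μ N v v).toReal, ← add_div, ← mul_div_assoc]
  refine div_le_div_of_nonneg_right ?_ ENNReal.toReal_nonneg
  rw [← div_eq_inv_mul, le_div_iff₀ hpos, mul_comm]
  exact key N

/-- A relative defect below one forces a nonzero Green function, so the walk reaches `y`. -/
theorem Attained.exists_mem_closure_support {v y : V} (h : Attained μ v y)
    (hrec : Tendsto (fun N => (green μ N v v).toReal) atTop atTop) :
    ∃ s ∈ Submonoid.closure μ.support, act s v = y := by
  obtain ⟨N, h1, h2⟩ := ((h.eventually (gt_mem_nhds (zero_lt_one (α := ℝ)))).and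
    (hrec.eventually_gt_atTop 0)).exists
  have hne : green μ N v y ≠ 0 := by
    intro h0
    rw [h0, ENNReal.toReal_zero, sub_zero, div_self h2.ne'] at h1
    exact lt_irrefl _ h1
  obtain ⟨n, -, hn⟩ := Finset.exists_ne_zero_of_sum_ne_zero hne
  exact exists_mem_closure_support_of_transition_ne_zero μ hn

/-- If the walk is recurrent, the Green function is asymptotically constant on the orbit. -/
theorem attained_of_mem_closedGroup [G.LocallyFinite] (hT : G.IsTree) {v : V}
    (hrec : Tendsto (fun N => (green μ N v v).toReal) atTop atTop) {g : Aff G ω}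
    (hg : g ∈ closedGroup μ) : Attained μ v (act g v) := by
  -- Inverses, because `Attained.act_inv` propagates along inverses of the support.
  set T := Submonoid.closure (μ.support)⁻¹ with hTdef
  have hatt : ∀ t ∈ T, ∀ y, Attained μ v y → Attained μ v (act t y) := by
    intro t ht
    induction ht using Submonoid.closure_induction with
    | mem t ht =>
      intro y hy
      have := hy.act_inv hrec ht
      rwa [inv_inv] at this
    | one => exact fun y hy => hy
    | mul s t _ _ hs ht => exact fun y hy => hs _ (ht _ hy)
  -- Vertices reached by `T` are attained, hence visited by the walk, that is, reached by inverses
  -- of elements of `T`. This makes the closure of `T` a group.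
  have horb : ∀ t ∈ T, ∃ t' ∈ T, act t v = act t'⁻¹ v := by
    intro t ht
    obtain ⟨s, hs, e⟩ := (hatt t ht v (attained_self v)).exists_mem_closure_support hrec
    exact ⟨s⁻¹, (Submonoid.mem_closure_inv _ _).2 (by rwa [inv_inv]), by rw [inv_inv, e]⟩
  have hgT := closedGroup_subset_topologicalClosure μ (T := T)
    (fun _ => inv_mem_topologicalClosure hT horb)
    (fun x hx => Submonoid.subset_closure (by rwa [Set.mem_inv, inv_inv])) hg
  -- The image of `v` is locally constant on the group, so `g` may be replaced by an element of `T`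
  -- itself.
  obtain ⟨t, e, ht⟩ := mem_closure_iff.1 hgT _ (isOpen_setOf_act_mem v {act g v}) rfl
  have e' : act t v = act g v := e
  rw [← e']
  exact hatt t ht v (attained_self v)

/-- If the walk is recurrent, its orbit has at most one point in every generation below a point
of the orbit. -/
theorem Attained.eq_of_parent_iterate_eq (hT : G.IsTree) {v y z : V} (hy : Attained μ v y)
    (hz : Attained μ v z) (hrec : Tendsto (fun N => (green μ N v v).toReal) atTop atTop) {k : ℕ}
    (hyv : (parent ω)^[k] y = v) (hzv : (parent ω)^[k] z = v) : y = z := by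
  by_contra hne
  -- Eventually each of the two values exceeds half the diagonal value, while their sum cannot
  -- exceed it.
  have hlt : ∀ {y}, Attained μ v y → ∀ᶠ N in atTop, ((green μ N v v).toReal -
      (green μ N v y).toReal) / (green μ N v v).toReal < 1 / 2 := fun h =>
    h.eventually (gt_mem_nhds (by norm_num))
  obtain ⟨N, ⟨h1, h2⟩, h3⟩ := (((hlt hy).and (hlt hz)).and (hrec.eventually_gt_atTop 0)).exists
  have h4 := ENNReal.toReal_mono (green_lt_top μ N v v).ne
    (green_add_green_le μ hT N k (v := v) hne hyv hzv)
  rw [ENNReal.toReal_add (green_lt_top μ N v y).ne (green_lt_top μ N v z).ne] at h4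
  rw [div_lt_iff₀ h3] at h1 h2
  linarith

end Recurrence

/-! ### Translation axes and transience -/

section Axis

variable {V : Type*} {G : SimpleGraph V} {ω : Boundary G}

theorem parent_iterate_eq_act_pow (hT : G.IsTree) {g : Aff G ω} {v : V}
    (hg : act g v = parent ω v) (n : ℕ) : (parent ω)^[n] v = act (g ^ n) v := by
  induction n with
  | zero => rfl
  | succ n ih =>
    rw [Function.iterate_succ_apply', ih, parent_act hT, ← hg, ← act_mul, ← pow_succ]

theorem parent_iterate_act_inv_pow (hT : G.IsTree) {g : Aff G ω} {v : V}
    (hg : act g v = parent ω v) (m n : ℕ) :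
    (parent ω)^[n] (act (g ^ (m + n))⁻¹ v) = act (g ^ m)⁻¹ v := by
  rw [parent_iterate_act hT, parent_iterate_eq_act_pow hT hg, ← act_mul, Nat.add_comm, pow_add,
    mul_inv_rev, inv_mul_cancel_right]

/-- The end that the axis of a translation towards `ω` has besides `ω`. -/
noncomputable def axisRay (hT : G.IsTree) {g : Aff G ω} {v : V} (hg : act g v = parent ω v) :
    Ray G where
  toFun n := act (g ^ n)⁻¹ v
  dist_eq m n h := by
    obtain ⟨k, rfl⟩ := Nat.exists_eq_add_of_le h
    rw [← parent_iterate_act_inv_pow hT hg m k, SimpleGraph.dist_comm, dist_parent_iterate hT,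
      Nat.add_sub_cancel_left]

/-- The axis ray descends; a ray towards `ω` ascends, and doing both would make a vertex its own
grandparent. -/
theorem axisRay_toEnd_ne (hT : G.IsTree) {g : Aff G ω} {v : V} (hg : act g v = parent ω v) :
    (axisRay hT hg).toEnd ≠ ω := by
  intro h
  have h1 := (axisRay hT hg).eq_parent_iterate hT h 1
  have h2 : (parent ω)^[2] ((axisRay hT hg).toFun 1) = (parent ω)^[0] ((axisRay hT hg).toFun 1) := by
    have h3 := parent_iterate_act_inv_pow hT hg 0 1
    change parent ω ((axisRay hT hg).toFun 1) = (axisRay hT hg).toFun 0 at h3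
    change parent ω (parent ω ((axisRay hT hg).toFun 1)) = (axisRay hT hg).toFun 1
    rw [h3]
    exact h1.symm
  exact absurd (parent_iterate_injective hT _ h2) (by norm_num)

open scoped ENNReal

variable [G.LocallyFinite] [Countable V] {μ : Measure (Aff G ω)} [IsProbabilityMeasure μ]

/-- If the walk is recurrent at a vertex of an axis, then its orbit is contained in the axis. -/
theorem act_eq_of_parent_iterate_eq (hT : G.IsTree) {g : Aff G ω} {v : V}
    (hgΓ : g ∈ closedGroup μ) (hg : act g v = parent ω v)
    (hrec : Tendsto (fun N => (green μ N v v).toReal) atTop atTop) {γ : Aff G ω}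
    (hγ : γ ∈ closedGroup μ) {a b : ℕ} (h : (parent ω)^[a] (act γ v) = (parent ω)^[b] v) :
    act γ v = act (g ^ b * (g ^ a)⁻¹) v := by
  -- Pulled back by `g ^ b`, the vertex `act γ v` lies `a` generations below `v`, as does `act (g ^
  -- a)⁻¹ v`; uniqueness in a generation identifies them.
  have h1 := attained_of_mem_closedGroup hT hrec
    (Subgroup.mul_mem _ (Subgroup.inv_mem _ (Subgroup.pow_mem _ hgΓ b)) hγ)
  have h2 := attained_of_mem_closedGroup hT hrec
    (Subgroup.inv_mem _ (Subgroup.pow_mem _ hgΓ a))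
  have h3 := h1.eq_of_parent_iterate_eq hT h2 hrec (k := a) ?_ ?_
  · rw [act_mul (g ^ b), ← h3, ← act_mul, mul_inv_cancel_left]
  · rw [act_mul, parent_iterate_act hT, h, parent_iterate_eq_act_pow hT hg, act_inv_act]
  · rw [parent_iterate_act hT, parent_iterate_eq_act_pow hT hg, act_inv_act]

/-- The random walk of a non-exceptional group is transient at the vertices of an axis. -/
theorem exists_green_le (hT : G.IsTree) {o : V} (hΓ : NonExceptional o (closedGroup μ))
    {g : Aff G ω} {v : V} (hgΓ : g ∈ closedGroup μ) (hg : act g v = parent ω v) :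
    ∃ C : ℝ≥0∞, C ≠ ∞ ∧ ∀ N, green μ N v v ≤ C := by
  by_contra! hunb
  have hrec : Tendsto (fun N => (green μ N v v).toReal) atTop atTop := by
    refine tendsto_atTop_atTop_of_monotone (fun M N h => ENNReal.toReal_mono
      (green_lt_top μ N v v).ne (green_mono μ v v h)) fun b => ?_
    obtain ⟨N, hN⟩ := hunb (ENNReal.ofReal b) ENNReal.ofReal_ne_top
    exact ⟨N, (ENNReal.ofReal_le_iff_le_toReal (green_lt_top μ N v v).ne).1 hN.le⟩
  obtain ⟨γ, hγ, hne⟩ := hΓ.2 _ (axisRay_toEnd_ne hT hg)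
  refine hne (Quotient.sound ?_)
  obtain ⟨a, b, -, h⟩ := exists_iterate_eq_iterate (ω := ω) hT (act γ v) v
  -- The element `γ` maps a tail of the axis into the axis with constant shift, hence fixes its
  -- lower end.
  refine ⟨b, a, fun n => ?_⟩
  change act γ (act (g ^ (n + b))⁻¹ v) = act (g ^ (n + a))⁻¹ v
  have h1 := act_eq_of_parent_iterate_eq hT hgΓ hg hrec (a := a + (n + b)) (b := b)
    (Subgroup.mul_mem _ hγ (Subgroup.inv_mem _ (Subgroup.pow_mem _ hgΓ (n + b)))) ?_
  · rw [← act_mul, h1, show a + (n + b) = n + a + b by ring, pow_add, mul_inv_rev,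
      mul_inv_cancel_left]
  · have h2 := parent_iterate_act_inv_pow hT hg 0 (n + b)
    rw [Nat.zero_add, pow_zero, inv_one, act_one] at h2
    rw [act_mul, Function.iterate_add_apply, parent_iterate_act hT γ (n + b), h2, h]

end Axis

/-! ### The walk: law, exits from and sojourns in sets of descendants -/

section Walk

open scoped ENNReal

variable {V : Type*} {G : SimpleGraph V} {ω : Boundary G}

/-- The layer-cake formula; it turns the sum over depths of the exit probabilities into a first
moment. -/
theorem tsum_measure_lt {α : Type*} [MeasurableSpace α] (ν : Measure α) {f : α → ℕ}
    (hf : Measurable f) : ∑' k : ℕ, ν {a | k < f a} = ∫⁻ a, (f a : ℝ≥0∞) ∂ν := by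
  have hm : ∀ k : ℕ, MeasurableSet {a | k < f a} := fun k => measurableSet_lt measurable_const hf
  simp_rw [← fun k => lintegral_indicator_one (μ := ν) (hm k)]
  rw [← lintegral_tsum fun k => (measurable_one.indicator (hm k)).aemeasurable]
  refine lintegral_congr fun a => ?_
  rw [tsum_eq_sum (s := Finset.range (f a))]
  · rw [Finset.sum_congr rfl (g := fun _ => 1) fun k hk => Set.indicator_of_mem
      (show a ∈ {a | k < f a} from Finset.mem_range.1 hk) _]
    simp
  · exact fun k hk => Set.indicator_of_notMem
      (show a ∉ {a | k < f a} from fun h => hk (Finset.mem_range.2 h)) _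

theorem phi_mul (hT : G.IsTree) (o : V) (g h : Aff G ω) :
    phi o (g * h) = phi o g + phi o h := by
  rw [phi, act_mul, height_act hT, add_comm]
  rfl

theorem height_rightWalk {Ω : Type*} {X : ℕ → Ω → Aff G ω} (hT : G.IsTree) (o x : V) (n : ℕ) (w : Ω) :
    height G ω o (act (rightWalk X n w) x) =
      height G ω o x + ∑ i ∈ Finset.range n, phi o (X i w) := by
  rw [height_act hT]
  congr 1
  induction n with
  | zero => exact height_eq hT (a := 0) (b := 0) rfl
  | succ n ih =>
    rw [Finset.sum_range_succ, ← ih]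
    exact phi_mul hT o _ _

variable {Ω : Type*} [MeasurableSpace Ω] {X : ℕ → Ω → Aff G ω} {P : Measure Ω}
  {μ : Measure (Aff G ω)}

/-- The strong law of large numbers for the height of the walk. -/
theorem ae_tendsto_sum_phi (hT : G.IsTree) {o : V} (hX : ∀ n, Measurable (X n))
    (hlaw : ∀ n, P.map (X n) = μ) (hindep : iIndepFun X P)
    (hmoment : Integrable (fun w => (seminorm o (X 0 w) : ℝ)) P)
    (hdrift : ∫ g, (phi o g : ℝ) ∂μ = 0) :
    ∀ᵐ w ∂P, Tendsto (fun n : ℕ => (∑ i ∈ Finset.range n, (phi o (X i w) : ℝ)) / n)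
      atTop (𝓝 0) := by
  have hphi : Measurable fun g : Aff G ω => (phi o g : ℝ) :=
    measurable_comp_act (fun y => (height G ω o y : ℝ)) o
  have hint : Integrable (fun w => (phi o (X 0 w) : ℝ)) P := by
    refine hmoment.mono' (hphi.comp (hX 0)).aestronglyMeasurable (ae_of_all _ fun w => ?_)
    rw [Real.norm_eq_abs]
    exact_mod_cast abs_phi_le hT o (X 0 w)
  have h := strong_law_ae_real (fun n w => (phi o (X n w) : ℝ)) hint
    (fun i j hij => (hindep.indepFun hij).comp hphi hphi)
    (fun i => (IdentDistrib.mk (hX i).aemeasurable (hX 0).aemeasurable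
      ((hlaw i).trans (hlaw 0).symm)).comp hphi)
  have h0 : ∫ w, (phi o (X 0 w) : ℝ) ∂P = 0 := by
    rw [← hdrift, ← hlaw 0, integral_map (hX 0).aemeasurable hphi.aestronglyMeasurable]
  rwa [h0] at h

variable [IsProbabilityMeasure μ] in
theorem lintegral_dist_act_ne_top (hT : G.IsTree) {o : V} (hX : Measurable (X 0))
    (hlaw : P.map (X 0) = μ) (hmoment : Integrable (fun w => (seminorm o (X 0 w) : ℝ)) P)
    (x : V) : ∫⁻ g, (G.dist x (act g x) : ℝ≥0∞) ∂μ ≠ ∞ := by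
  -- Changing the base point from `o` to `x` costs at most twice their distance.
  have hle : ∀ g : Aff G ω, (G.dist x (act g x) : ℝ≥0∞) ≤
      (2 * G.dist x o : ℕ) + (seminorm o g : ℝ≥0∞) := by
    intro g
    have h1 := hT.connected.dist_triangle (u := x) (v := o) (w := act g x)
    have h2 := hT.connected.dist_triangle (u := o) (v := act g o) (w := act g x)
    rw [dist_act_act, SimpleGraph.dist_comm (u := o) (v := x),
      SimpleGraph.dist_comm (u := o) (v := act g o)] at h2
    rw [seminorm]
    exact_mod_cast (by omega : G.dist x (act g x) ≤ 2 * G.dist x o + G.dist (act g o) o)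
  have hmeas : Measurable fun g : Aff G ω => (seminorm o g : ℝ≥0∞) :=
    measurable_comp_act (fun y => (G.dist y o : ℝ≥0∞)) o
  have hfin : ∫⁻ g, (seminorm o g : ℝ≥0∞) ∂μ < ∞ := by
    rw [← hlaw, lintegral_map hmeas hX]
    simpa using hmoment.lintegral_lt_top
  refine ((lintegral_mono hle).trans_lt ?_).ne
  rw [lintegral_add_left measurable_const]
  simpa [ENNReal.mul_lt_top_iff] using hfin

variable [Countable V]

instance : MeasurableMul₂ (Aff G ω) := ContinuousMul.measurableMul₂

theorem measurable_rightWalk (hX : ∀ n, Measurable (X n)) (n : ℕ) :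
    Measurable (rightWalk X n) := by
  induction n with
  | zero => exact measurable_const
  | succ n ih => exact ih.mul (hX n)

theorem indepFun_rightWalk (hX : ∀ n, Measurable (X n)) (hindep : iIndepFun X P) (n : ℕ) :
    IndepFun (rightWalk X n) (X n) P := by
  have h1 := indep_iSup_of_disjoint (fun i => (hX i).comap_le) hindep.iIndep
    (S := {i | i < n}) (T := {n}) (by simp)
  rw [IndepFun_iff_Indep]
  refine indep_of_indep_of_le_left (indep_of_indep_of_le_right h1 ?_) ?_
  · exact le_iSup₂_of_le n rfl le_rfl
  -- Induction on `m ≤ n` keeps the σ-algebra of the first `n` increments fixed.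
  · have hmeas : ∀ m ≤ n, Measurable[⨆ i ∈ {i | i < n}, MeasurableSpace.comap (X i) inferInstance]
        (rightWalk X m) := by
      intro m
      induction m with
      | zero => exact fun _ => measurable_const
      | succ m ih =>
        intro hm
        refine (ih (Nat.le_of_succ_le hm)).mul ?_
        exact (comap_measurable (X m)).mono (le_iSup₂_of_le m hm le_rfl) le_rfl
    exact (hmeas n le_rfl).comap_le

variable [IsProbabilityMeasure P]

theorem map_rightWalk (hX : ∀ n, Measurable (X n)) (hlaw : ∀ n, P.map (X n) = μ)
    (hindep : iIndepFun X P) (n : ℕ) : P.map (rightWalk X n) = convPow μ n := by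
  induction n with
  | zero =>
    have : rightWalk X 0 = fun _ => (1 : Aff G ω) := rfl
    rw [this, Measure.map_const, measure_univ, one_smul]
    rfl
  | succ n ih =>
    have : rightWalk X (n + 1) = rightWalk X n * X n := rfl
    rw [this, (indepFun_rightWalk hX hindep n).map_mul_eq_map_mconv_map
      (measurable_rightWalk hX n) (hX n), ih, hlaw n]
    rfl

theorem measure_rightWalk_eq (hT : G.IsTree) (hX : ∀ n, Measurable (X n))
    (hlaw : ∀ n, P.map (X n) = μ) (hindep : iIndepFun X P) (n k : ℕ) (x v : V) :
    P {w | (parent ω)^[k] (act (rightWalk X n w) x) = v} =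
      transition μ n ((parent ω)^[k] x) v := by
  rw [← convPow_parent_iterate_act μ hT, ← map_rightWalk hX hlaw hindep,
    Measure.map_apply (measurable_rightWalk hX n)]
  · rfl
  · exact (isOpen_setOf_act_mem x {y | (parent ω)^[k] y = v}).measurableSet

variable {v : V} {C : ℝ≥0∞}

variable [IsProbabilityMeasure μ]

/-- Uniform in the starting vertex, and valid for time windows that do not begin at zero. -/
theorem sum_transition_le (hC : ∀ N, green μ N v v ≤ C) (s : Finset ℕ) (x : V) :
    ∑ n ∈ s, transition μ n x v ≤ C := by
  obtain ⟨N, hN⟩ := s.exists_nat_subset_range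
  exact (Finset.sum_le_sum_of_subset hN).trans ((green_le_right μ N x v).trans (hC N))

theorem tsum_transition_le (hC : ∀ N, green μ N v v ≤ C) (x : V) :
    ∑' n, transition μ n x v ≤ C :=
  ENNReal.tsum_le_of_sum_range_le fun _ => sum_transition_le hC _ x

/-- The walk leaves the set of descendants of a transient vertex finitely many times. -/
theorem ae_eventually_mem_descendants_of_mem (hT : G.IsTree) (hX : ∀ n, Measurable (X n))
    (hlaw : ∀ n, P.map (X n) = μ) (hindep : iIndepFun X P) (hCtop : C ≠ ∞)
    (hC : ∀ N, green μ N v v ≤ C) {x : V} (hx : ∫⁻ g, (G.dist x (act g x) : ℝ≥0∞) ∂μ ≠ ∞) :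
    ∀ᵐ w ∂P, ∀ᶠ n in atTop, act (rightWalk X n w) x ∈ descendants ω v →
      act (rightWalk X (n + 1) w) x ∈ descendants ω v := by
  -- An exit from depth `k` needs an increment moving `x` by more than `k`, and this increment is
  -- independent of the current position.
  have hexit : ∀ n, P {w | act (rightWalk X n w) x ∈ descendants ω v ∧
      act (rightWalk X (n + 1) w) x ∉ descendants ω v} ≤
      ∑' k, transition μ n ((parent ω)^[k] x) v * μ {g | k < G.dist x (act g x)} := by
    intro n
    have hsub : {w | act (rightWalk X n w) x ∈ descendants ω v ∧
        act (rightWalk X (n + 1) w) x ∉ descendants ω v} ⊆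
        ⋃ k, (rightWalk X n ⁻¹' {g | (parent ω)^[k] (act g x) = v} ∩
          X n ⁻¹' {g | k < G.dist x (act g x)}) := by
      rintro w ⟨⟨k, hk⟩, hw⟩
      refine Set.mem_iUnion.2 ⟨k, hk, ?_⟩
      have := lt_dist_of_notMem_descendants hT hk hw
      rwa [show rightWalk X (n + 1) w = rightWalk X n w * X n w from rfl, act_mul,
        dist_act_act] at this
    refine (measure_mono hsub).trans ((measure_iUnion_le _).trans (ENNReal.tsum_le_tsum fun k => ?_))
    have h2 : MeasurableSet {g : Aff G ω | k < G.dist x (act g x)} :=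
      (isOpen_setOf_act_mem x {y | k < G.dist x y}).measurableSet
    have h3 : MeasurableSet {g : Aff G ω | (parent ω)^[k] (act g x) = v} :=
      (isOpen_setOf_act_mem x {y | (parent ω)^[k] y = v}).measurableSet
    rw [(indepFun_rightWalk hX hindep n).measure_inter_preimage_eq_mul _ _ h3 h2,
      ← Measure.map_apply (hX n) h2, hlaw n, ← measure_rightWalk_eq hT hX hlaw hindep n k x v]
    rfl
  have hsum : ∑' n, P {w | act (rightWalk X n w) x ∈ descendants ω v ∧
      act (rightWalk X (n + 1) w) x ∉ descendants ω v} ≠ ∞ := by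
    refine ne_top_of_le_ne_top (ENNReal.mul_ne_top hCtop hx)
      ((ENNReal.tsum_le_tsum hexit).trans ?_)
    rw [ENNReal.tsum_comm, ← tsum_measure_lt μ (measurable_comp_act (fun y => G.dist x y) x),
      ← ENNReal.tsum_mul_left]
    refine ENNReal.tsum_le_tsum fun k => ?_
    rw [ENNReal.tsum_mul_right]
    gcongr
    exact tsum_transition_le hC _
  filter_upwards [ae_eventually_notMem hsum] with w hw
  filter_upwards [hw] with n hn hmem
  by_contra hnot
  exact hn ⟨hmem, hnot⟩

/-- The probability that from time `N` on the walk stays among the descendants of a transient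
vertex, at depth at most `n / m` at time `n`, is at most `2 * C / m`. -/
theorem mul_measure_forall_le (hT : G.IsTree) (hX : ∀ n, Measurable (X n))
    (hlaw : ∀ n, P.map (X n) = μ) (hindep : iIndepFun X P)
    (hC : ∀ N, green μ N v v ≤ C) (x : V) {m : ℕ} (hm : 0 < m) (N : ℕ) :
    m * P {w | ∀ n ≥ N, ∃ k, (parent ω)^[k] (act (rightWalk X n w) x) = v ∧ m * k ≤ n} ≤
      2 * C := by
  set F := {w | ∀ n ≥ N, ∃ k, (parent ω)^[k] (act (rightWalk X n w) x) = v ∧ m * k ≤ n}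
  -- At times before `N + M` the admissible depths are below `K`. The choice `M = N + m` gives `m *
  -- K ≤ N + M + m = 2 * M`.
  set M := N + m with hM
  set K := (N + M) / m + 1 with hK
  have hmK : m * K ≤ 2 * M := by
    have := Nat.mul_div_le (N + M) m
    rw [hK, mul_add]
    omega
  have h1 : ∀ n ∈ Finset.Ico N (N + M), P F ≤
      ∑ k ∈ Finset.range K, transition μ n ((parent ω)^[k] x) v := by
    intro n hn
    rw [Finset.mem_Ico] at hn
    have hsub : F ⊆ ⋃ k ∈ Finset.range K,
        {w | (parent ω)^[k] (act (rightWalk X n w) x) = v} := by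
      intro w hw
      obtain ⟨k, hk, hkn⟩ := hw n hn.1
      simp only [Set.mem_iUnion]
      refine ⟨k, Finset.mem_range.2 (Nat.lt_succ_of_le ?_), hk⟩
      rw [Nat.le_div_iff_mul_le hm, mul_comm]
      omega
    refine (measure_mono hsub).trans ((measure_biUnion_finset_le _ _).trans_eq ?_)
    exact Finset.sum_congr rfl fun k _ => measure_rightWalk_eq hT hX hlaw hindep n k x v
  -- On `F`, each of the `M` times of the window is spent at one of `K` depths, and each depth has
  -- expected occupation time at most `C`.
  have h2 : (M : ℝ≥0∞) * P F ≤ K * C := by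
    calc (M : ℝ≥0∞) * P F = ∑ n ∈ Finset.Ico N (N + M), P F := by simp
      _ ≤ ∑ n ∈ Finset.Ico N (N + M), ∑ k ∈ Finset.range K,
          transition μ n ((parent ω)^[k] x) v := Finset.sum_le_sum h1
      _ = ∑ k ∈ Finset.range K, ∑ n ∈ Finset.Ico N (N + M),
          transition μ n ((parent ω)^[k] x) v := Finset.sum_comm
      _ ≤ ∑ k ∈ Finset.range K, C := Finset.sum_le_sum fun k _ => sum_transition_le hC _ _
      _ = K * C := by simp
  have hM0 : (M : ℝ≥0∞) ≠ 0 := by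
    rw [Nat.cast_ne_zero]; omega
  refine (ENNReal.mul_le_mul_iff_right hM0 (ENNReal.natCast_ne_top M)).1 ?_
  calc (M : ℝ≥0∞) * (m * P F) = m * (M * P F) := by ring
    _ ≤ m * (K * C) := by gcongr
    _ = ((m * K : ℕ) : ℝ≥0∞) * C := by push_cast; ring
    _ ≤ ((2 * M : ℕ) : ℝ≥0∞) * C := by gcongr
    _ = M * (2 * C) := by push_cast; ring

/-- The walk does not stay among the descendants of a transient vertex. -/
theorem ae_frequently_notMem_descendants (hT : G.IsTree) {o : V} (hX : ∀ n, Measurable (X n))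
    (hlaw : ∀ n, P.map (X n) = μ) (hindep : iIndepFun X P)
    (hmoment : Integrable (fun w => (seminorm o (X 0 w) : ℝ)) P)
    (hdrift : ∫ g, (phi o g : ℝ) ∂μ = 0) (hCtop : C ≠ ∞) (hC : ∀ N, green μ N v v ≤ C) (x : V) :
    ∀ᵐ w ∂P, ∃ᶠ n in atTop, act (rightWalk X n w) x ∉ descendants ω v := by
  let F : ℕ → ℕ → Set Ω := fun m N =>
    {w | ∀ n ≥ N, ∃ k, (parent ω)^[k] (act (rightWalk X n w) x) = v ∧ m * k ≤ n}
  have hF : ∀ m : ℕ, 0 < m → (m : ℝ≥0∞) * P (⋃ N, F m N) ≤ 2 * C := by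
    intro m hm
    have hmono : Monotone (F m) := fun N M hNM w hw n hn => hw n (hNM.trans hn)
    rw [hmono.measure_iUnion, ENNReal.mul_iSup]
    exact iSup_le fun N => mul_measure_forall_le hT hX hlaw hindep hC x hm N
  have hsub : ∀ m : ℕ, 0 < m → ∀ᵐ w ∂P,
      (∀ᶠ n in atTop, act (rightWalk X n w) x ∈ descendants ω v) → w ∈ ⋃ N, F m N := by
    intro m hm
    filter_upwards [ae_tendsto_sum_phi hT hX hlaw hindep hmoment hdrift] with w hw hmem
    have hm' : (0 : ℝ) < m := Nat.cast_pos.2 hm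
    -- While the walk is below `v`, its depth is its height minus that of `v`; divided by `n` this
    -- tends to zero.
    have hlim : Tendsto (fun n : ℕ => ((height G ω o x - height G ω o v : ℤ) : ℝ) / n +
        (∑ i ∈ Finset.range n, (phi o (X i w) : ℝ)) / n) atTop (𝓝 0) := by
      simpa using (tendsto_const_div_atTop_nhds_zero_nat _).add hw
    obtain ⟨N, hN⟩ := eventually_atTop.1 ((hmem.and
      (hlim.eventually (gt_mem_nhds (inv_pos.2 hm')))).and (eventually_gt_atTop 0))
    refine Set.mem_iUnion.2 ⟨N, fun n hn => ?_⟩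
    obtain ⟨⟨⟨k, hk⟩, hlt⟩, hn0⟩ := hN n hn
    refine ⟨k, hk, ?_⟩
    have hh := height_parent_iterate (ω := ω) hT o (act (rightWalk X n w) x) k
    rw [hk, height_rightWalk hT] at hh
    have hkr : (k : ℝ) = ((height G ω o x - height G ω o v : ℤ) : ℝ) +
        ∑ i ∈ Finset.range n, (phi o (X i w) : ℝ) := by
      have : (k : ℤ) = height G ω o x - height G ω o v +
        ∑ i ∈ Finset.range n, phi o (X i w) := by linarith
      exact_mod_cast this
    rw [← add_div, ← hkr, div_lt_iff₀ (Nat.cast_pos.2 hn0), ← div_eq_inv_mul, lt_div_iff₀ hm',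
      mul_comm] at hlt
    exact_mod_cast hlt.le
  have hle : ∀ m : ℕ, 0 < m → (m : ℝ≥0∞) *
      P {w | ∀ᶠ n in atTop, act (rightWalk X n w) x ∈ descendants ω v} ≤ 2 * C := by
    intro m hm
    refine le_trans ?_ (hF m hm)
    exact mul_le_mul_right (measure_mono_ae (hsub m hm)) _
  have hzero : P {w | ∀ᶠ n in atTop, act (rightWalk X n w) x ∈ descendants ω v} = 0 := by
    by_contra hne
    obtain ⟨m, hm⟩ := ENNReal.exists_nat_mul_gt hne (ENNReal.mul_ne_top (ENNReal.ofNat_ne_top (n := 2)) hCtop)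
    rcases Nat.eq_zero_or_pos m with rfl | hpos
    · simp at hm
    · exact absurd (hle m hpos) (not_le.2 hm)
  have := measure_eq_zero_iff_ae_notMem.1 hzero
  filter_upwards [this] with w hw hev
  exact hw (hev.mono fun n hn => not_not.1 hn)

/-- The walk visits finitely often the descendants of a transient vertex. -/
theorem ae_eventually_notMem_descendants (hT : G.IsTree) {o : V} (hX : ∀ n, Measurable (X n))
    (hlaw : ∀ n, P.map (X n) = μ) (hindep : iIndepFun X P)
    (hmoment : Integrable (fun w => (seminorm o (X 0 w) : ℝ)) P)
    (hdrift : ∫ g, (phi o g : ℝ) ∂μ = 0) (hCtop : C ≠ ∞) (hC : ∀ N, green μ N v v ≤ C) (x : V) :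
    ∀ᵐ w ∂P, ∀ᶠ n in atTop, act (rightWalk X n w) x ∉ descendants ω v := by
  filter_upwards [ae_eventually_mem_descendants_of_mem hT hX hlaw hindep hCtop hC
      (lintegral_dist_act_ne_top hT (hX 0) (hlaw 0) hmoment x),
    ae_frequently_notMem_descendants hT hX hlaw hindep hmoment hdrift hCtop hC x] with w h1 h2
  obtain ⟨N, hN⟩ := eventually_atTop.1 h1
  refine eventually_atTop.2 ⟨N, fun n hn hmem => ?_⟩
  -- After time `N` there are no exits, so a single visit would confine the walk for ever.
  refine h2 (eventually_atTop.2 ⟨n, fun m hm => not_not.2 ?_⟩)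
  induction m, hm using Nat.le_induction with
  | base => exact hmem
  | succ m hm ih => exact hN m (hn.trans hm) ih

end Walk

end OrientedTree

/-! ### Conclusion along the axis -/

open OrientedTree in
theorem mainTheorem7 {V : Type*} (G : SimpleGraph V) [G.LocallyFinite] (q : ℕ)
    (hTree : G.IsTree) (hReg : G.IsRegularOfDegree (q + 1))
    (ω : OrientedTree.Boundary G) (o : V)
    (μ : Measure (OrientedTree.Aff G ω)) [IsProbabilityMeasure μ]
    (hΓ : OrientedTree.NonExceptional o (OrientedTree.closedGroup μ))
    (hφΓ : ∀ k : ℤ, ∃ g ∈ OrientedTree.closedGroup μ, OrientedTree.phi o g = k)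
    {Ω : Type*} [MeasurableSpace Ω] (P : Measure Ω) [IsProbabilityMeasure P]
    (X : ℕ → Ω → OrientedTree.Aff G ω)
    (hX : ∀ n, Measurable (X n)) (hlaw : ∀ n, P.map (X n) = μ) (hindep : iIndepFun X P)
    (hmoment : Integrable (fun w => (OrientedTree.seminorm o (X 0 w) : ℝ)) P)
    (hdrift : ∫ g, (OrientedTree.phi o g : ℝ) ∂μ = 0) :
    ∀ᵐ w ∂P, OrientedTree.ConvergesToEnd (fun n => OrientedTree.rightWalk X n w) ω := by
  have _ : Countable V := countable_of_isTree hTree ω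
  -- Heights decrease towards `ω`, so `g` moves the `a`-th ancestor of `o`, and every vertex above
  -- it, to its parent.
  obtain ⟨g, hg, hgφ⟩ := hφΓ (-1)
  obtain ⟨a, b, -, hab⟩ := exists_iterate_eq_iterate (ω := ω) hTree (act g o) o
  have hb : b = a + 1 := by
    rw [phi, height_eq hTree hab] at hgφ
    omega
  have haxis : ∀ j, act g ((parent ω)^[j] ((parent ω)^[a] o)) =
      parent ω ((parent ω)^[j] ((parent ω)^[a] o)) := fun j => by
    rw [← parent_iterate_act hTree, ← parent_iterate_act hTree, hab, hb,
      Function.iterate_succ_apply', ← Function.iterate_succ_apply,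
      Function.iterate_succ_apply']
  have hall : ∀ᵐ w ∂P, ∀ (x : V) (j : ℕ), ∀ᶠ n in atTop, act (rightWalk X n w) x ∉
      descendants ω ((parent ω)^[j] ((parent ω)^[a] o)) := by
    rw [ae_all_iff]
    intro x
    rw [ae_all_iff]
    intro j
    obtain ⟨C, hCtop, hC⟩ := exists_green_le hTree hΓ hg (haxis j)
    exact ae_eventually_notMem_descendants hTree hX hlaw hindep hmoment hdrift hCtop hC x
  filter_upwards [hall] with w hw x
  refine tendsto_boundary hTree fun v => ?_
  -- Some ancestor of `v` lies on the axis, so avoiding the descendants of countably many axis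
  -- vertices suffices.
  obtain ⟨c, d, -, hcd⟩ := exists_iterate_eq_iterate (ω := ω) hTree v ((parent ω)^[a] o)
  filter_upwards [hw x d] with n hn hmem
  exact hn (hcd ▸ descendants_subset v c hmem)
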